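/- Consider classical propositional linear logic LL over an arbitrary set of atoms, with constants $1,\bot,\top,0$ and connectives $(-)^\bot,\otimes,⅋,\&,\oplus,!,?$, given by the usual two-sided sequent calculus with cut. For an interpretation of the constants and connectives as objects and operations on objects of a category $\mathcal D$, every valuation $v$ of the atoms by objects of $\mathcal D$ extends to an interpretation $[\![\varphi]\!]_v$ of formulas. A formula $\varphi$ is *validated* if $\hom(1,[\![\varphi]\!]_v)\neq\varnothing$ for all $v$; the interpretation is *sound* (*complete*) for LL if, for all formulas $\varphi,\psi$, derivability of $\varphi\vdash\psi$ in LL implies (is implied by) the condition that $\hom([\![\varphi]\!]_v,[\![\psi]\!]_v)\neq\varnothing$ for all $v$. (1) The formula $\bot\otimes\top$ is not provable in LL. (2) Let $\mathcal R$ be a model of multiplicative exponential linear logic, that is, a symmetric monoidal adjunction $L\dashv M:R\to S$ between a $*$-autonomous category $R$ and a category $S$ with finite products, with $!A=LMA$ and $?A=(!A^\bot)^\bot$. Its dialectica category $\mathfrak D_l(R)$ has as objects the families $\mathcal G^X_Y=(\mathcal G^x_y)_{x\in X,y\in Y}$ of objects of $R$, where $X,Y$ are sets that are not both empty; a morphism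 $\mathcal G^X_Y\to\mathcal H^U_V$ is a triple of maps $f:X\to U$, $g:V\to Y$ and a family of morphisms $\mathcal G^x_{gv}\to\mathcal H^{fx}_v$ of $R$ $(x\in X,v\in V)$. LL is interpreted in it by - $1$ and $\bot$: the families with $X=Y=\{*\}$ and value $1$, respectively $\bot=1^\bot$; - $\top$: $X=\{*\}$, $Y=\varnothing$; $\;0$: $X=\varnothing$, $Y=\{*\}$; - $(\mathcal G^X_Y)^\bot$: index sets $Y$ and $X$, value $(\mathcal G^x_y)^\bot$ at $\binom{y}{x}$; - $\mathcal G^X_Y\otimes\mathcal H^U_V$: index sets $X\times U$ and $(U\to Y)\times(X\to V)$, value $\mathcal G^x_{fu}\otimes\mathcal H^u_{gx}$ at $\binom{x,u}{f,g}$; dually $\mathcal G^X_Y⅋\mathcal H^U_V$: index sets $(V\to X)\times(Y\to U)$ and $Y\times V$, value $\mathcal G^{fv}_y⅋\mathcal H^{gy}_v$ at $\binom{f,g}{y,v}$; - $\mathcal G^X_Y\&\mathcal H^U_V$: index sets $X\times U$ and $Y+V$, value $\mathcal G^x_z$ for $z\in Y$ and $\mathcal H^u_z$ for $z\in V$; dually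 $\mathcal G^X_Y\oplus\mathcal H^U_V$: index sets $X+U$ and $Y\times V$, value $\mathcal G^z_y$ for $z\in X$ and $\mathcal H^z_v$ for $z\in U$; - $!\mathcal G^X_Y$: index sets $X$ and $X\to Y^*$ ($Y^*$ the set of finite multisets in $Y$), value $\bigotimes_{y\in fx}!\mathcal G^x_y$ at $\binom{x}{f}$; dually $?\mathcal G^X_Y$: index sets $Y\to X^*$ and $Y$, value $⅋_{x\in gy}?\mathcal G^x_y$ at $\binom{g}{y}$. Then $\bot\otimes\top\cong\top$ in $\mathfrak D_l(R)$, the formula $\bot\otimes\top$ is validated, and the interpretation is not complete for LL; in particular it is not both sound and complete. (3) The same holds over any cartesian closed base. Let $\mathcal C$ be a cartesian closed category with finite coproducts, and let $E$ be an indexed $*$-autonomous category over $\mathcal C$ (a pseudofunctor on $\mathcal C^{op}$ with $*$-autonomous fibres and reindexing functors preserving $\otimes$, $1$ and $(-)^\bot$) such that $E(0)$ is equivalent to the terminal category for every initial object $0$ and $E(A+B)\simeq E(A)\times E(B)$ by restriction. Its dialectica category has as objects triples $(X,Y,G)$ with $X,Y\in\mathcal C$ and $G\in E(X\times Y)$;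 a morphism $(X,Y,G)\to(U,V,H)$ consists of $f:X\to U$, $g:V\to Y$ and a morphism $(X\times g)^*G\to(f\times V)^*H$ in $E(X\times V)$; the constants and the connectives other than $!,?$ are interpreted by the formulas of (2) read in $\mathcal C$ and $E$. Then $\bot\otimes\top\cong\top$ and, whatever operation on objects interprets $!$ (with $?G=(!G^\bot)^\bot$), the formula $\bot\otimes\top$ is validated and the interpretation is not complete for LL; in particular it is not both sound and complete. Hence no dialectica category is both sound and complete for classical linear logic. -/

import Mathlib

open CategoryTheory MonoidalCategory CartesianMonoidalCategory Limits

universe w v u v' u' a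

/-! ## Propositional classical linear logic -/

/-- Formulas of full propositional classical linear logic over a type of atoms; linear implication
`φ ⊸ ψ` is the usual abbreviation for `φ^⊥ ⅋ ψ`. -/
inductive LLFormula (Atom : Type a) : Type a
  | atom (p : Atom) : LLFormula Atom
  | neg (φ : LLFormula Atom) : LLFormula Atom
  | one : LLFormula Atom
  | bot : LLFormula Atom
  | tensor (φ ψ : LLFormula Atom) : LLFormula Atom
  | par (φ ψ : LLFormula Atom) : LLFormula Atom
  | top : LLFormula Atom
  | zero : LLFormula Atom
  | and (φ ψ : LLFormula Atom) : LLFormula Atom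
  | plus (φ ψ : LLFormula Atom) : LLFormula Atom
  | bang (φ : LLFormula Atom) : LLFormula Atom
  | whynot (φ : LLFormula Atom) : LLFormula Atom

namespace LLFormula

/-- The two-sided sequent calculus of classical linear logic, with cut. Sequents `Γ ⊢ Δ` are pairs
of finite multisets of formulas, so the exchange rules are built in. -/
inductive Derivable {Atom : Type a} :
    Multiset (LLFormula Atom) → Multiset (LLFormula Atom) → Prop
  | ax (φ) : Derivable {φ} {φ}
  | cut {Γ Γ' Δ Δ'} (φ) :
      Derivable Γ (φ ::ₘ Δ) → Derivable (φ ::ₘ Γ') Δ' → Derivable (Γ + Γ') (Δ + Δ')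
  | negL {Γ Δ φ} : Derivable Γ (φ ::ₘ Δ) → Derivable (neg φ ::ₘ Γ) Δ
  | negR {Γ Δ φ} : Derivable (φ ::ₘ Γ) Δ → Derivable Γ (neg φ ::ₘ Δ)
  | oneL {Γ Δ} : Derivable Γ Δ → Derivable (one ::ₘ Γ) Δ
  | oneR : Derivable 0 {one}
  | botL : Derivable {bot} 0
  | botR {Γ Δ} : Derivable Γ Δ → Derivable Γ (bot ::ₘ Δ)
  | tensorL {Γ Δ φ ψ} : Derivable (φ ::ₘ ψ ::ₘ Γ) Δ → Derivable (tensor φ ψ ::ₘ Γ) Δ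
  | tensorR {Γ Γ' Δ Δ' φ ψ} : Derivable Γ (φ ::ₘ Δ) → Derivable Γ' (ψ ::ₘ Δ') →
      Derivable (Γ + Γ') (tensor φ ψ ::ₘ (Δ + Δ'))
  | parL {Γ Γ' Δ Δ' φ ψ} : Derivable (φ ::ₘ Γ) Δ → Derivable (ψ ::ₘ Γ') Δ' →
      Derivable (par φ ψ ::ₘ (Γ + Γ')) (Δ + Δ')
  | parR {Γ Δ φ ψ} : Derivable Γ (φ ::ₘ ψ ::ₘ Δ) → Derivable Γ (par φ ψ ::ₘ Δ)
  | topR (Γ Δ) : Derivable Γ (top ::ₘ Δ)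
  | zeroL (Γ Δ) : Derivable (zero ::ₘ Γ) Δ
  | withL₁ {Γ Δ φ} (ψ) : Derivable (φ ::ₘ Γ) Δ → Derivable (LLFormula.and φ ψ ::ₘ Γ) Δ
  | withL₂ {Γ Δ ψ} (φ) : Derivable (ψ ::ₘ Γ) Δ → Derivable (LLFormula.and φ ψ ::ₘ Γ) Δ
  | withR {Γ Δ φ ψ} :
      Derivable Γ (φ ::ₘ Δ) → Derivable Γ (ψ ::ₘ Δ) → Derivable Γ (LLFormula.and φ ψ ::ₘ Δ)
  | plusL {Γ Δ φ ψ} :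
      Derivable (φ ::ₘ Γ) Δ → Derivable (ψ ::ₘ Γ) Δ → Derivable (plus φ ψ ::ₘ Γ) Δ
  | plusR₁ {Γ Δ φ} (ψ) : Derivable Γ (φ ::ₘ Δ) → Derivable Γ (plus φ ψ ::ₘ Δ)
  | plusR₂ {Γ Δ ψ} (φ) : Derivable Γ (ψ ::ₘ Δ) → Derivable Γ (plus φ ψ ::ₘ Δ)
  | bangDereliction {Γ Δ φ} : Derivable (φ ::ₘ Γ) Δ → Derivable (bang φ ::ₘ Γ) Δ
  | bangWeakening {Γ Δ} (φ) : Derivable Γ Δ → Derivable (bang φ ::ₘ Γ) Δ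
  | bangContraction {Γ Δ φ} :
      Derivable (bang φ ::ₘ bang φ ::ₘ Γ) Δ → Derivable (bang φ ::ₘ Γ) Δ
  | bangPromotion {Γ Δ : Multiset (LLFormula Atom)} {φ} :
      Derivable (Γ.map bang) (φ ::ₘ Δ.map whynot) →
      Derivable (Γ.map bang) (bang φ ::ₘ Δ.map whynot)
  | whynotDereliction {Γ Δ φ} : Derivable Γ (φ ::ₘ Δ) → Derivable Γ (whynot φ ::ₘ Δ)
  | whynotWeakening {Γ Δ} (φ) : Derivable Γ Δ → Derivable Γ (whynot φ ::ₘ Δ)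
  | whynotContraction {Γ Δ φ} :
      Derivable Γ (whynot φ ::ₘ whynot φ ::ₘ Δ) → Derivable Γ (whynot φ ::ₘ Δ)
  | whynotPromotion {Γ Δ : Multiset (LLFormula Atom)} {φ} :
      Derivable (φ ::ₘ Γ.map bang) (Δ.map whynot) →
      Derivable (whynot φ ::ₘ Γ.map bang) (Δ.map whynot)

/-- A formula is provable when the sequent `⊢ φ` is derivable. -/
def Provable {Atom : Type a} (φ : LLFormula Atom) : Prop := Derivable 0 {φ}

end LLFormula

/-! ## Interpretation of formulas in a category -/

/-- The object part of an interpretation of linear logic in a category: one operation for each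
constant and connective. It is only used for the two families of dialectica categories built
below. -/
structure LLInterpretation (D : Type u) where
  neg : D → D
  one : D
  bot : D
  tensor : D → D → D
  par : D → D → D
  top : D
  zero : D
  and : D → D → D
  plus : D → D → D
  bang : D → D
  whynot : D → D

namespace LLInterpretation

variable {D : Type u} (I : LLInterpretation D)

/-- The interpretation of a formula under a valuation of the atoms. -/
def eval {Atom : Type a} (val : Atom → D) : LLFormula Atom → D
  | .atom p => val p
  | .neg φ => I.neg (eval val φ)
  | .one => I.one
  | .bot => I.bot
  | .tensor φ ψ => I.tensor (eval val φ) (eval val ψ)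
  | .par φ ψ => I.par (eval val φ) (eval val ψ)
  | .top => I.top
  | .zero => I.zero
  | .and φ ψ => I.and (eval val φ) (eval val ψ)
  | .plus φ ψ => I.plus (eval val φ) (eval val ψ)
  | .bang φ => I.bang (eval val φ)
  | .whynot φ => I.whynot (eval val φ)

variable [Category.{v} D]

/-- A formula is validated when under every valuation it has a global element `1 ⟶ ⟦φ⟧`. -/
def Validates {Atom : Type a} (φ : LLFormula Atom) : Prop :=
  ∀ val : Atom → D, Nonempty (I.one ⟶ I.eval val φ)

/-- Soundness for classical linear logic with atoms in `Atom`. -/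
def IsSound (Atom : Type a) : Prop :=
  ∀ φ ψ : LLFormula Atom, LLFormula.Derivable {φ} {ψ} →
    ∀ val : Atom → D, Nonempty (I.eval val φ ⟶ I.eval val ψ)

/-- Completeness for classical linear logic with atoms in `Atom`. -/
def IsComplete (Atom : Type a) : Prop :=
  ∀ φ ψ : LLFormula Atom, (∀ val : Atom → D, Nonempty (I.eval val φ ⟶ I.eval val ψ)) →
    LLFormula.Derivable {φ} {ψ}

end LLInterpretation

/-! ## `*`-autonomous categories and linear-nonlinear adjunctions -/

/-- A `*`-autonomous category: a symmetric monoidal closed category with a contravariant functor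
`(-)^⊥`, a natural isomorphism `A^⊥^⊥ ≅ A`, and bijections
`Hom (A ⊗ B, C^⊥) ≃ Hom (A, (B ⊗ C)^⊥)` natural in `A`, `B`, `C`. -/
class StarAutonomous (R : Type u) [Category.{v} R] [MonoidalCategory R] [SymmetricCategory R]
    extends MonoidalClosed R where
  neg : Rᵒᵖ ⥤ R
  negNeg : neg.rightOp ⋙ neg ≅ 𝟭 R
  homEquiv (A B C : R) : (A ⊗ B ⟶ neg.obj (.op C)) ≃ (A ⟶ neg.obj (.op (B ⊗ C)))
  homEquiv_naturality {A A' B B' C C' : R} (f : A' ⟶ A) (g : B' ⟶ B) (h : C' ⟶ C)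
    (k : A ⊗ B ⟶ neg.obj (.op C)) :
    homEquiv A' B' C' ((f ⊗ₘ g) ≫ k ≫ neg.map h.op) =
      f ≫ homEquiv A B C k ≫ neg.map (g ⊗ₘ h).op

namespace StarAutonomous

variable {R : Type u} [Category.{v} R] [MonoidalCategory R] [SymmetricCategory R]
  [StarAutonomous R]

/-- Linear negation on objects. -/
def dual (A : R) : R := (neg (R := R)).obj (.op A)

variable (R) in
/-- The multiplicative falsity `⊥ = 1^⊥`. -/
def bot : R := dual (𝟙_ R)

/-- The multiplicative disjunction `A ⅋ B = (A^⊥ ⊗ B^⊥)^⊥`. -/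
def par (A B : R) : R := dual (dual A ⊗ dual B)

end StarAutonomous

/-- A linear-nonlinear adjunction `L ⊣ M : R → S` between a `*`-autonomous category `R` and a
category `S` with finite products, that is, a model of multiplicative exponential linear logic:
`L` and `M` are lax symmetric monoidal, and so are the unit and the counit. -/
structure LinearNonlinearAdjunction (R : Type u) [Category.{v} R] [MonoidalCategory R]
    [SymmetricCategory R] [StarAutonomous R] (S : Type u') [Category.{v'} S]
    [CartesianMonoidalCategory S] [SymmetricCategory S] where
  L : S ⥤ R
  M : R ⥤ S
  [laxL : L.LaxBraided]
  [laxM : M.LaxBraided]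
  adj : L ⊣ M
  unit_isMonoidal : NatTrans.IsMonoidal adj.unit
  counit_isMonoidal : NatTrans.IsMonoidal adj.counit

namespace LinearNonlinearAdjunction

variable {R : Type u} [Category.{v} R] [MonoidalCategory R] [SymmetricCategory R]
  [StarAutonomous R] {S : Type u'} [Category.{v'} S] [CartesianMonoidalCategory S]
  [SymmetricCategory S] (ℛ : LinearNonlinearAdjunction R S)

/-- The exponential `!A = L (M A)`. -/
def bang (A : R) : R := ℛ.L.obj (ℛ.M.obj A)

/-- The exponential `?A = (!(A^⊥))^⊥`. -/
def whynot (A : R) : R := StarAutonomous.dual (ℛ.bang (StarAutonomous.dual A))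

end LinearNonlinearAdjunction

/-! ## The linear dialectica transformation over sets -/

/-- Objects of the linear dialectica transformation of `R`: families of objects of `R` indexed by
pairs of elements of two sets that are not both empty. -/
structure Dialectica (R : Type u) where
  X : Type w
  Y : Type w
  nonempty : Nonempty X ∨ Nonempty Y
  fam : X → Y → R

namespace Dialectica

section Category

variable {R : Type u} [Category.{v} R]

/-- A morphism `(f, g, α)` of the linear dialectica transformation. -/
@[ext]
structure Hom (G H : Dialectica.{w} R) where
  f : G.X → H.X
  g : H.Y → G.Y
  α : ∀ (x : G.X) (y : H.Y), G.fam x (g y) ⟶ H.fam (f x) y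

instance : Category (Dialectica.{w} R) where
  Hom := Hom
  id G := ⟨id, id, fun _ _ => 𝟙 _⟩
  comp m n := ⟨n.f ∘ m.f, m.g ∘ n.g, fun x y => m.α x (n.g y) ≫ n.α (m.f x) y⟩

end Category

section Additives

variable {R : Type u}

/-- The object `⊤`: one witness and no counter-witness. -/
def top : Dialectica.{w} R := ⟨PUnit, PEmpty, .inl ⟨⟨⟩⟩, fun _ y => y.elim⟩

/-- The object `0`: no witness and one counter-witness. -/
def zero : Dialectica.{w} R := ⟨PEmpty, PUnit, .inr ⟨⟨⟩⟩, fun x _ => x.elim⟩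

/-- Additive conjunction. -/
def and (G H : Dialectica.{w} R) : Dialectica.{w} R where
  X := G.X × H.X
  Y := G.Y ⊕ H.Y
  nonempty := by
    rcases G.nonempty with ⟨⟨x⟩⟩ | ⟨⟨y⟩⟩
    · rcases H.nonempty with ⟨⟨u⟩⟩ | ⟨⟨z⟩⟩
      · exact .inl ⟨(x, u)⟩
      · exact .inr ⟨.inr z⟩
    · exact .inr ⟨.inl y⟩
  fam x z := Sum.elim (G.fam x.1) (H.fam x.2) z

/-- Additive disjunction. -/
def plus (G H : Dialectica.{w} R) : Dialectica.{w} R where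
  X := G.X ⊕ H.X
  Y := G.Y × H.Y
  nonempty := by
    rcases G.nonempty with ⟨⟨x⟩⟩ | ⟨⟨y⟩⟩
    · exact .inl ⟨.inl x⟩
    · rcases H.nonempty with ⟨⟨u⟩⟩ | ⟨⟨z⟩⟩
      · exact .inl ⟨.inr u⟩
      · exact .inr ⟨(y, z)⟩
  fam z y := Sum.elim (fun x => G.fam x y.1) (fun x => H.fam x y.2) z

end Additives

variable {R : Type u} [Category.{v} R] [MonoidalCategory R] [SymmetricCategory R]
  [StarAutonomous R]

/-- The multiplicative unit. -/
def one : Dialectica.{w} R := ⟨PUnit, PUnit, .inl ⟨⟨⟩⟩, fun _ _ => 𝟙_ R⟩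

/-- The multiplicative falsity. -/
def bot : Dialectica.{w} R := ⟨PUnit, PUnit, .inl ⟨⟨⟩⟩, fun _ _ => StarAutonomous.bot R⟩

/-- Linear negation. -/
def neg (G : Dialectica.{w} R) : Dialectica.{w} R :=
  ⟨G.Y, G.X, G.nonempty.symm, fun y x => StarAutonomous.dual (G.fam x y)⟩

/-- Multiplicative conjunction. -/
def tensor (G H : Dialectica.{w} R) : Dialectica.{w} R where
  X := G.X × H.X
  Y := (H.X → G.Y) × (G.X → H.Y)
  nonempty := by
    rcases isEmpty_or_nonempty G.X with hG | hG
    · obtain ⟨y⟩ := G.nonempty.resolve_left (not_nonempty_iff.2 hG)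
      exact .inr ⟨(fun _ => y, fun x => hG.elim x)⟩
    · rcases isEmpty_or_nonempty H.X with hH | hH
      · obtain ⟨y⟩ := H.nonempty.resolve_left (not_nonempty_iff.2 hH)
        exact .inr ⟨(fun x => hH.elim x, fun _ => y)⟩
      · exact .inl inferInstance
  fam x p := G.fam x.1 (p.1 x.2) ⊗ H.fam x.2 (p.2 x.1)

/-- Multiplicative disjunction. -/
def par (G H : Dialectica.{w} R) : Dialectica.{w} R where
  X := (H.Y → G.X) × (G.Y → H.X)
  Y := G.Y × H.Y
  nonempty := (tensor (neg G) (neg H)).nonempty.symm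
  fam p y := StarAutonomous.par (G.fam (p.1 y.2) y.1) (H.fam (p.2 y.1) y.2)

variable {S : Type u'} [Category.{v'} S] [CartesianMonoidalCategory S] [SymmetricCategory S]
  (ℛ : LinearNonlinearAdjunction R S)

/-- The exponential `!`. The fold of `⊗` over a finite multiset is taken along an enumeration of
the multiset; by symmetry its isomorphism class does not depend on the enumeration. -/
noncomputable def bang (G : Dialectica.{w} R) : Dialectica.{w} R where
  X := G.X
  Y := G.X → Multiset G.Y
  nonempty := .inr ⟨fun _ => 0⟩
  fam x f := ((f x).toList.map fun y => ℛ.bang (G.fam x y)).foldr (fun A B => A ⊗ B) (𝟙_ R)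

/-- The exponential `?`. -/
noncomputable def whynot (G : Dialectica.{w} R) : Dialectica.{w} R where
  X := G.Y → Multiset G.X
  Y := G.Y
  nonempty := .inl ⟨fun _ => 0⟩
  fam g y := ((g y).toList.map fun x => ℛ.whynot (G.fam x y)).foldr StarAutonomous.par
    (StarAutonomous.bot R)

/-- The interpretation of linear logic in the dialectica transformation of `ℛ`. -/
noncomputable def interpretation : LLInterpretation (Dialectica.{w} R) where
  neg := neg
  one := one
  bot := bot
  tensor := tensor
  par := par
  top := top
  zero := zero
  and := and
  plus := plus
  bang := bang ℛ
  whynot := whynot ℛ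

end Dialectica

/-! ## Dialectica categories over a cartesian closed base -/

/-- A category indexed over `C` (equivalently, a cloven fibration over `C`): the fibre over `A`
replaces the category of `A`-indexed families of objects of `R`. -/
abbrev IndexedCategory (C : Type u) [Category.{v} C] :=
  Pseudofunctor (LocallyDiscrete Cᵒᵖ) Cat.{v', u'}

namespace IndexedCategory

variable {C : Type u} [Category.{v} C] (E : IndexedCategory.{v, u, v', u'} C)

/-- The fibre over `A`. -/
abbrev Fib (A : C) : Type u' := E.obj ⟨.op A⟩

/-- Reindexing along `h`. -/
abbrev pull {A B : C} (h : A ⟶ B) : E.Fib B ⥤ E.Fib A := (E.map h.op.toLoc).toFunctor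

/-- The canonical isomorphism `(h ≫ k)^* G ≅ h^* (k^* G)`. -/
def pullComp {A B D : C} (h : A ⟶ B) (k : B ⟶ D) (l : A ⟶ D) (e : h ≫ k = l) (G : E.Fib D) :
    (E.pull l).obj G ≅ (E.pull h).obj ((E.pull k).obj G) :=
  (Cat.Hom.toNatIso (E.mapComp' k.op.toLoc h.op.toLoc l.op.toLoc (by subst e; rfl))).app G

/-- Reindexing a morphism `k^* G ⟶ k'^* G'` along `h`, up to the canonical isomorphisms. -/
def res {A B D D' : C} (h : A ⟶ B) {k : B ⟶ D} {k' : B ⟶ D'} {G : E.Fib D} {G' : E.Fib D'}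
    (φ : (E.pull k).obj G ⟶ (E.pull k').obj G') (l : A ⟶ D) (l' : A ⟶ D')
    (e : h ≫ k = l) (e' : h ≫ k' = l') : (E.pull l).obj G ⟶ (E.pull l').obj G' :=
  (E.pullComp h k l e G).hom ≫ (E.pull h).map φ ≫ (E.pullComp h k' l' e' G').inv

theorem res_comp {A B D D' D'' : C} (h : A ⟶ B) {k : B ⟶ D} {k' : B ⟶ D'} {k'' : B ⟶ D''}
    {G : E.Fib D} {G' : E.Fib D'} {G'' : E.Fib D''}
    (φ : (E.pull k).obj G ⟶ (E.pull k').obj G') (ψ : (E.pull k').obj G' ⟶ (E.pull k'').obj G'')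
    (l : A ⟶ D) (l' : A ⟶ D') (l'' : A ⟶ D'')
    (e : h ≫ k = l) (e' : h ≫ k' = l') (e'' : h ≫ k'' = l'') :
    E.res h (φ ≫ ψ) l l'' e e'' = E.res h φ l l' e e' ≫ E.res h ψ l' l'' e' e'' := by
  simp [res]

theorem res_id {A B D : C} (h : A ⟶ B) (k : B ⟶ D) (G : E.Fib D) (l : A ⟶ D) (e : h ≫ k = l) :
    E.res h (𝟙 ((E.pull k).obj G)) l l e e = 𝟙 _ := by
  simp [res]

theorem pullComp_id (B D : C) (k : B ⟶ D) (G : E.Fib D) :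
    (E.pullComp (𝟙 B) k k (by simp) G).hom =
      (E.mapId ⟨.op B⟩).inv.toNatTrans.app ((E.pull k).obj G) := by
  have := E.mapComp'_comp_id_hom k.op.toLoc
  have := congrArg (fun t => t.toNatTrans.app G) this
  simp at this
  exact this

theorem res_one {B D D' : C} {k : B ⟶ D} {k' : B ⟶ D'} {G : E.Fib D} {G' : E.Fib D'}
    (φ : (E.pull k).obj G ⟶ (E.pull k').obj G') :
    E.res (𝟙 B) φ k k' (by simp) (by simp) = φ := by
  rw [res, ← Category.assoc, Iso.comp_inv_eq, pullComp_id, pullComp_id]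
  exact ((E.mapId ⟨.op B⟩).inv.toNatTrans.naturality φ).symm

theorem pullComp_assoc {A B D F : C} (h : A ⟶ B) (k : B ⟶ D) (m : D ⟶ F)
    (hk : A ⟶ D) (km : B ⟶ F) (l : A ⟶ F) (e₁ : h ≫ k = hk) (e₂ : k ≫ m = km) (e₃ : h ≫ km = l)
    (e₄ : hk ≫ m = l) (G : E.Fib F) :
    (E.pullComp h km l e₃ G).hom ≫ (E.pull h).map (E.pullComp k m km e₂ G).hom =
      (E.pullComp hk m l e₄ G).hom ≫ (E.pullComp h k hk e₁ ((E.pull m).obj G)).hom := by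
  have := E.mapComp'₀₂₃_hom_comp_mapComp'_hom_whiskerRight m.op.toLoc k.op.toLoc h.op.toLoc
    km.op.toLoc hk.op.toLoc l.op.toLoc (by subst e₂; rfl) (by subst e₁; rfl) (by subst e₃; rfl)
  have := congrArg (fun t => t.toNatTrans.app G) this
  simpa [pullComp] using this

theorem res_res {A' A B D D' : C} (h' : A' ⟶ A) (h : A ⟶ B) (h'' : A' ⟶ B) {k : B ⟶ D}
    {k' : B ⟶ D'} {G : E.Fib D} {G' : E.Fib D'}
    (φ : (E.pull k).obj G ⟶ (E.pull k').obj G') (l : A ⟶ D) (l' : A ⟶ D') (m : A' ⟶ D)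
    (m' : A' ⟶ D') (e : h ≫ k = l) (e' : h ≫ k' = l') (e₁ : h' ≫ l = m) (e₁' : h' ≫ l' = m')
    (e₂ : h' ≫ h = h'') :
    E.res h' (E.res h φ l l' e e') m m' e₁ e₁' =
      E.res h'' φ m m' (by rw [← e₂, Category.assoc, e, e₁])
        (by rw [← e₂, Category.assoc, e', e₁']) := by
  have nat : (E.pull h'').map φ ≫ (E.pullComp h' h h'' e₂ _).hom =
      (E.pullComp h' h h'' e₂ _).hom ≫ (E.pull h').map ((E.pull h).map φ) :=
    (E.mapComp' h.op.toLoc h'.op.toLoc h''.op.toLoc (by subst e₂; rfl)).hom.toNatTrans.naturality φ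
  have p₁ := E.pullComp_assoc h' h k h'' l m e₂ e e₁ (by rw [← e₂, Category.assoc, e, e₁]) G
  have p₂ := E.pullComp_assoc h' h k' h'' l' m' e₂ e' e₁'
    (by rw [← e₂, Category.assoc, e', e₁']) G'
  unfold res
  rw [← Category.assoc, Iso.comp_inv_eq]
  simp only [Functor.map_comp, Category.assoc]
  rw [reassoc_of% p₁, ← reassoc_of% nat]
  congr 2
  rw [← Iso.inv_comp_eq] at p₂
  rw [← cancel_mono ((E.pull h').map (E.pullComp h k' l' e' G').hom)]
  simp only [Category.assoc]
  rw [← Functor.map_comp, Iso.inv_hom_id, CategoryTheory.Functor.map_id, Category.comp_id, p₂]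

end IndexedCategory

/-- An indexed `*`-autonomous category over `C`: the fibres are `*`-autonomous, the reindexing
functors are strong symmetric monoidal and preserve negation, and the coherence isomorphisms are
monoidal. -/
class IndexedStarAutonomous {C : Type u} [Category.{v} C]
    (E : IndexedCategory.{v, u, v', u'} C) where
  [monoidal (A : C) : MonoidalCategory (E.Fib A)]
  [symmetric (A : C) : SymmetricCategory (E.Fib A)]
  [starAutonomous (A : C) : StarAutonomous (E.Fib A)]
  [braided {A B : C} (h : A ⟶ B) : (E.pull h).Braided]
  pullNeg {A B : C} (h : A ⟶ B) :
    (E.pull h).op ⋙ StarAutonomous.neg ≅ StarAutonomous.neg ⋙ E.pull h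
  mapId_isMonoidal (A : C) : NatTrans.IsMonoidal (F₁ := E.pull (𝟙 A)) (F₂ := 𝟭 (E.Fib A))
    (E.mapId ⟨.op A⟩).hom.toNatTrans
  mapComp_isMonoidal {A B D : C} (h : A ⟶ B) (k : B ⟶ D) :
    NatTrans.IsMonoidal (F₁ := E.pull (h ≫ k)) (F₂ := E.pull k ⋙ E.pull h)
      (E.mapComp k.op.toLoc h.op.toLoc).hom.toNatTrans

attribute [reducible, instance] IndexedStarAutonomous.monoidal IndexedStarAutonomous.symmetric
  IndexedStarAutonomous.starAutonomous IndexedStarAutonomous.braided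

/-- The fibres behave like categories of families with respect to finite coproducts: a family
indexed by an initial object is nothing, and a family indexed by a binary coproduct is a pair of
families. -/
class IndexedCategory.IsExtensive {C : Type u} [Category.{v} C] [HasFiniteCoproducts C]
    (E : IndexedCategory.{v, u, v', u'} C) : Prop where
  initial (A : C) (hA : IsInitial A) : Nonempty (E.Fib A ≌ Discrete PUnit.{1})
  coprod (A B : C) :
    ((E.pull (coprod.inl : A ⟶ A ⨿ B)).prod' (E.pull (coprod.inr : B ⟶ A ⨿ B))).IsEquivalence

attribute [instance] IndexedCategory.IsExtensive.coprod

/-- The family indexed by `A ⨿ B` that is given by two families indexed by `A` and by `B`. -/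
noncomputable def IndexedCategory.copair {C : Type u} [Category.{v} C] [HasFiniteCoproducts C]
    (E : IndexedCategory.{v, u, v', u'} C) [E.IsExtensive] {A B : C} (G : E.Fib A)
    (H : E.Fib B) : E.Fib (A ⨿ B) :=
  ((E.pull (coprod.inl : A ⟶ A ⨿ B)).prod' (E.pull (coprod.inr : B ⟶ A ⨿ B))).inv.obj (G, H)

/-- Objects of the dialectica category of an indexed category `E` over a base with finite
products: objects `X`, `Y` of the base and an object of the fibre over `X × Y`. -/
structure IndexedDialectica {C : Type u} [Category.{v} C] [CartesianMonoidalCategory C]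
    (E : IndexedCategory.{v, u, v', u'} C) where
  X : C
  Y : C
  fam : E.Fib (X ⊗ Y)

namespace IndexedDialectica

section Category

variable {C : Type u} [Category.{v} C] [CartesianMonoidalCategory C]
  {E : IndexedCategory.{v, u, v', u'} C}

/-- A morphism `(f, g, α)`, where `α` is a morphism `G^x_{g v} ⟶ H^{f x}_v` in the fibre over the
product of the object of the `x` and the object of the `v`. -/
structure Hom (G H : IndexedDialectica E) where
  f : G.X ⟶ H.X
  g : H.Y ⟶ G.Y
  α : (E.pull (G.X ◁ g)).obj G.fam ⟶ (E.pull (f ▷ H.Y)).obj H.fam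

theorem Hom.ext' {G H : IndexedDialectica E} {m n : Hom G H} (hf : m.f = n.f) (hg : m.g = n.g)
    (hα : E.res (𝟙 _) m.α (G.X ◁ n.g) (n.f ▷ H.Y) (by rw [hg, Category.id_comp])
      (by rw [hf, Category.id_comp]) = n.α) : m = n := by
  obtain ⟨f, g, α⟩ := m
  obtain ⟨f', g', α'⟩ := n
  obtain rfl : f = f' := hf
  obtain rfl : g = g' := hg
  rw [IndexedCategory.res_one] at hα
  rw [show α = α' from hα]

/-- The identity is `(𝟙, 𝟙, 𝟙)`, up to the canonical isomorphisms. -/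
abbrev Hom.id (G : IndexedDialectica E) : Hom G G :=
  ⟨𝟙 _, 𝟙 _, E.res (𝟙 _) (𝟙 ((E.pull (𝟙 _)).obj G.fam)) _ _ (by simp) (by simp)⟩

/-- Composition is `(f, g, α) ≫ (f', g', β) = (f ≫ f', g' ≫ g, α_{x, g' q} ≫ β_{f x, q})`, up to
the canonical isomorphisms. -/
abbrev Hom.comp {G H K : IndexedDialectica E} (m : Hom G H) (n : Hom H K) : Hom G K :=
  ⟨m.f ≫ n.f, n.g ≫ m.g,
    E.res (G.X ◁ n.g) m.α _ (m.f ⊗ₘ n.g) (by simp) (by rw [MonoidalCategory.tensorHom_def']) ≫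
      E.res (m.f ▷ K.Y) n.α (m.f ⊗ₘ n.g) _ (by rw [MonoidalCategory.tensorHom_def]) (by simp)⟩

instance : Category (IndexedDialectica E) where
  Hom := Hom
  id := Hom.id
  comp := Hom.comp
  id_comp {G H} m := by
    refine Hom.ext' (Category.id_comp _) (Category.comp_id _) ?_
    change E.res _ (E.res (G.X ◁ m.g) (E.res _ _ _ _ _ _) _ (𝟙 G.X ⊗ₘ m.g) _ _ ≫
      E.res (𝟙 G.X ▷ H.Y) m.α _ _ _ _) _ _ _ _ = m.α
    rw [E.res_res _ _ (G.X ◁ m.g) _ _ _ _ _ _ _ _ _ (by simp),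
      E.res_comp (l' := G.X ◁ m.g) (e' := by simp), E.res_res _ _ (G.X ◁ m.g) (e₂ := by simp),
      E.res_id, Category.id_comp, E.res_res _ _ (𝟙 _) (e₂ := by simp), E.res_one]
  comp_id {G H} m := by
    refine Hom.ext' (Category.comp_id _) (Category.id_comp _) ?_
    change E.res _ (E.res (G.X ◁ 𝟙 H.Y) m.α _ (m.f ⊗ₘ 𝟙 H.Y) _ _ ≫
      E.res (m.f ▷ H.Y) (E.res _ _ _ _ _ _) _ _ _ _) _ _ _ _ = m.α
    rw [E.res_res _ _ (m.f ▷ H.Y) _ _ _ _ _ _ _ _ _ (by simp),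
      E.res_comp (l' := m.f ▷ H.Y) (e' := by simp), E.res_res _ _ (𝟙 _) (e₂ := by simp),
      E.res_one, E.res_res _ _ (m.f ▷ H.Y) (e₂ := by simp), E.res_id, Category.comp_id]
  assoc {G H K L} m n p := by
    refine Hom.ext' (Category.assoc _ _ _) (Category.assoc _ _ _).symm ?_
    change E.res _ (E.res (G.X ◁ p.g) (E.res (G.X ◁ n.g) m.α _ _ _ _ ≫
        E.res (m.f ▷ K.Y) n.α _ _ _ _) _ ((m.f ≫ n.f) ⊗ₘ p.g) _ _ ≫
          E.res ((m.f ≫ n.f) ▷ L.Y) p.α _ _ _ _) _ _ _ _ =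
      E.res (G.X ◁ (p.g ≫ n.g)) m.α _ (m.f ⊗ₘ (p.g ≫ n.g)) _ _ ≫
        E.res (m.f ▷ L.Y) (E.res (H.X ◁ p.g) n.α _ _ _ _ ≫ E.res (n.f ▷ L.Y) p.α _ _ _ _) _ _ _ _
    have e₁ : G.X ◁ p.g ≫ (m.f ⊗ₘ n.g) = m.f ⊗ₘ (p.g ≫ n.g) := by
      simp [MonoidalCategory.tensorHom_def']
    have e₂ : m.f ▷ L.Y ≫ (n.f ⊗ₘ p.g) = (m.f ≫ n.f) ⊗ₘ p.g := by
      simp [MonoidalCategory.tensorHom_def]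
    have e₃ : G.X ◁ p.g ≫ m.f ▷ K.Y = m.f ⊗ₘ p.g := by rw [MonoidalCategory.tensorHom_def']
    have e₄ : m.f ▷ L.Y ≫ H.X ◁ p.g = m.f ⊗ₘ p.g := by rw [MonoidalCategory.tensorHom_def]
    rw [E.res_comp (G.X ◁ p.g) _ _ _ _ _ _ e₁, E.res_comp (m.f ▷ L.Y) _ _ _ _ _ _ e₂,
      E.res_res _ _ _ (e₂ := e₃), E.res_res _ _ _ (e₂ := e₄),
      E.res_res _ _ (G.X ◁ (p.g ≫ n.g)) (e₂ := by simp),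
      E.res_res _ _ ((m.f ≫ n.f) ▷ L.Y) (e₂ := by simp),
      E.res_comp (l' := (m.f ≫ n.f) ⊗ₘ p.g) (e' := by simp),
      E.res_comp (l' := m.f ⊗ₘ (p.g ≫ n.g)) (e' := by simp),
      E.res_res _ _ _ (e₂ := Category.id_comp _), E.res_res _ _ _ (e₂ := Category.id_comp _),
      E.res_res _ _ _ (e₂ := Category.id_comp _), Category.assoc]

end Category

variable {C : Type u} [Category.{v} C] [CartesianMonoidalCategory C]
  {E : IndexedCategory.{v, u, v', u'} C} [IndexedStarAutonomous E]

/-- The multiplicative unit. -/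
def one : IndexedDialectica E := ⟨𝟙_ C, 𝟙_ C, 𝟙_ _⟩

/-- The multiplicative falsity. -/
def bot : IndexedDialectica E := ⟨𝟙_ C, 𝟙_ C, StarAutonomous.bot _⟩

/-- Linear negation. -/
def neg (G : IndexedDialectica E) : IndexedDialectica E :=
  ⟨G.Y, G.X, StarAutonomous.dual ((E.pull (lift (snd G.Y G.X) (fst G.Y G.X))).obj G.fam)⟩

section Closed

variable [MonoidalClosed C]

/-- Multiplicative conjunction: the fibre over `(x, u, f, g)` is `G^x_{f u} ⊗ H^u_{g x}`. -/
def tensor (G H : IndexedDialectica E) : IndexedDialectica E where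
  X := G.X ⊗ H.X
  Y := (ihom H.X).obj G.Y ⊗ (ihom G.X).obj H.Y
  fam :=
    (E.pull (lift (fst _ _ ≫ fst _ _)
      (lift (fst _ _ ≫ snd _ _) (snd _ _ ≫ fst _ _) ≫ (ihom.ev H.X).app G.Y))).obj G.fam ⊗
    (E.pull (lift (fst _ _ ≫ snd _ _)
      (lift (fst _ _ ≫ fst _ _) (snd _ _ ≫ snd _ _) ≫ (ihom.ev G.X).app H.Y))).obj H.fam

/-- Multiplicative disjunction: the fibre over `(f, g, y, v)` is `G^{f v}_y ⅋ H^{g y}_v`. -/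
def par (G H : IndexedDialectica E) : IndexedDialectica E where
  X := (ihom H.Y).obj G.X ⊗ (ihom G.Y).obj H.X
  Y := G.Y ⊗ H.Y
  fam := StarAutonomous.par
    ((E.pull (lift
      (lift (snd _ _ ≫ snd _ _) (fst _ _ ≫ fst _ _) ≫ (ihom.ev H.Y).app G.X)
      (snd _ _ ≫ fst _ _))).obj G.fam)
    ((E.pull (lift
      (lift (snd _ _ ≫ fst _ _) (fst _ _ ≫ snd _ _) ≫ (ihom.ev G.Y).app H.X)
      (snd _ _ ≫ snd _ _))).obj H.fam)

end Closed

section Additives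

variable [HasFiniteCoproducts C]

/-- The object `⊤`, with `X` terminal and `Y` initial. In an extensive indexed category over a
cartesian closed base all objects of the fibre over `X × Y` are isomorphic. -/
noncomputable def top : IndexedDialectica E := ⟨𝟙_ C, ⊥_ C, 𝟙_ _⟩

/-- The object `0`, with `X` initial and `Y` terminal. -/
noncomputable def zero : IndexedDialectica E := ⟨⊥_ C, 𝟙_ C, 𝟙_ _⟩

variable [MonoidalClosed C]

/-- The distributivity morphism `A × (B + D) ⟶ A × B + A × D`. -/
noncomputable def distrib (A B D : C) : A ⊗ (B ⨿ D) ⟶ (A ⊗ B) ⨿ (A ⊗ D) :=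
  MonoidalClosed.uncurry
    (coprod.desc (MonoidalClosed.curry coprod.inl) (MonoidalClosed.curry coprod.inr))

variable [E.IsExtensive]

/-- Additive conjunction: the fibre over `(x, u, z)` is `G^x_z` for `z` in `Y`, and `H^u_z` for `z`
in `V`. -/
noncomputable def and (G H : IndexedDialectica E) : IndexedDialectica E where
  X := G.X ⊗ H.X
  Y := G.Y ⨿ H.Y
  fam := (E.pull (distrib (G.X ⊗ H.X) G.Y H.Y)).obj (E.copair
    ((E.pull (lift (fst _ _ ≫ fst _ _) (snd _ _))).obj G.fam)
    ((E.pull (lift (fst _ _ ≫ snd _ _) (snd _ _))).obj H.fam))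

/-- Additive disjunction: the fibre over `(z, y, v)` is `G^z_y` for `z` in `X`, and `H^z_v` for `z`
in `U`. -/
noncomputable def plus (G H : IndexedDialectica E) : IndexedDialectica E where
  X := G.X ⨿ H.X
  Y := G.Y ⊗ H.Y
  fam := (E.pull (lift (snd _ _) (fst _ _) ≫ distrib (G.Y ⊗ H.Y) G.X H.X)).obj (E.copair
    ((E.pull (lift (snd _ _) (fst _ _ ≫ fst _ _))).obj G.fam)
    ((E.pull (lift (snd _ _) (fst _ _ ≫ snd _ _))).obj H.fam))

variable (bang : IndexedDialectica E → IndexedDialectica E)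

/-- The interpretation of linear logic in the dialectica category of `E`, for a given
interpretation of the exponential `!` on objects. -/
noncomputable def interpretation : LLInterpretation (IndexedDialectica E) where
  neg := neg
  one := one
  bot := bot
  tensor := tensor
  par := par
  top := top
  zero := zero
  and := and
  plus := plus
  bang := bang
  whynot G := neg (bang (neg G))

end Additives

end IndexedDialectica

/-!
Two-valued classical semantics is sound for linear logic and refutes `⊥ ⊗ ψ` for every `ψ`, so no
interpretation that validates `⊥ ⊗ ⊤` is complete. In a dialectica category, an object whose
witnesses form a terminal object and whose counter-witnesses form an initial object is terminal,
because there is exactly one morphism between any two families over an initial object. Evaluation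
at the witness of `⊥` maps the counter-witnesses of `⊥ ⊗ ⊤` to those of `⊤`, that is, to an initial
object. Initial objects of a cartesian closed category are strict, so `⊥ ⊗ ⊤` has no
counter-witnesses and is terminal like `⊤`.
-/

namespace LLFormula

variable {Atom : Type a}

/-- Two-valued classical truth of a formula under a valuation of the atoms: multiplicatives and
additives are identified, and the exponentials are trivial. -/
def Holds (val : Atom → Prop) : LLFormula Atom → Prop
  | .atom p => val p
  | .neg φ => ¬ φ.Holds val
  | .one => True
  | .bot => False
  | .tensor φ ψ => φ.Holds val ∧ ψ.Holds val
  | .par φ ψ => φ.Holds val ∨ ψ.Holds val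
  | .top => True
  | .zero => False
  | .and φ ψ => φ.Holds val ∧ ψ.Holds val
  | .plus φ ψ => φ.Holds val ∨ ψ.Holds val
  | .bang φ => φ.Holds val
  | .whynot φ => φ.Holds val

/-- Two-valued classical truth of the sequent `Γ ⊢ Δ` under a valuation of the atoms. -/
def Entails (val : Atom → Prop) (Γ Δ : Multiset (LLFormula Atom)) : Prop :=
  (∀ φ ∈ Γ, φ.Holds val) → ∃ ψ ∈ Δ, ψ.Holds val

section Entails

variable {val : Atom → Prop} {Γ Γ' Δ Δ' : Multiset (LLFormula Atom)} {φ : LLFormula Atom}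

theorem not_entails_zero_zero : ¬ Entails val 0 0 := by
  simp [Entails]

theorem entails_cons_left : Entails val (φ ::ₘ Γ) Δ ↔ (φ.Holds val → Entails val Γ Δ) := by
  simp [Entails]

theorem entails_cons_right : Entails val Γ (φ ::ₘ Δ) ↔ φ.Holds val ∨ Entails val Γ Δ := by
  simp only [Entails, Multiset.mem_cons, exists_eq_or_imp]
  tauto

theorem entails_add : Entails val (Γ + Γ') (Δ + Δ') ↔ Entails val Γ Δ ∨ Entails val Γ' Δ' := by
  simp only [Entails, Multiset.mem_add, or_imp, forall_and, or_and_right, exists_or]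
  grind

theorem Derivable.entails (h : Derivable Γ Δ) (val : Atom → Prop) : Entails val Γ Δ := by
  induction h <;>
    simp only [← Multiset.cons_zero, entails_cons_left, entails_cons_right, entails_add,
      not_entails_zero_zero, Holds] at * <;>
    tauto

end Entails

theorem not_provable_tensor_bot (ψ : LLFormula Atom) : ¬ (tensor bot ψ).Provable := fun h => by
  simpa [Entails, Holds] using h.entails fun _ => False

theorem provable_of_derivable_one {φ : LLFormula Atom} (h : Derivable {one} {φ}) :
    φ.Provable := by
  simpa [Provable] using Derivable.cut (Δ := 0) (Γ' := 0) .one .oneR h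

end LLFormula

namespace LLInterpretation

variable {D : Type u} [Category.{v} D] {I : LLInterpretation D} {Atom : Type a}

theorem IsComplete.provable_of_validates (hI : I.IsComplete Atom) {φ : LLFormula Atom}
    (hφ : I.Validates φ) : φ.Provable :=
  LLFormula.provable_of_derivable_one (hI .one φ hφ)

end LLInterpretation

namespace Dialectica

variable {R : Type u} [Category.{v} R]

def isTerminalOfUniqueXOfIsEmptyY (G : Dialectica.{w} R) [Unique G.X] [IsEmpty G.Y] :
    IsTerminal G :=
  .ofUniqueHom (fun _ => ⟨default, isEmptyElim, fun _ => isEmptyElim⟩) fun _ m => by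
    obtain ⟨f, g, α⟩ := m
    obtain rfl : f = default := Subsingleton.elim _ _
    obtain rfl : g = isEmptyElim := Subsingleton.elim _ _
    exact congrArg _ (Subsingleton.elim _ _)

instance : Unique (top.{w} (R := R)).X := inferInstanceAs (Unique PUnit)

instance : IsEmpty (top.{w} (R := R)).Y := inferInstanceAs (IsEmpty PEmpty)

variable [MonoidalCategory R] [SymmetricCategory R] [StarAutonomous R]

instance : Unique (bot.{w} (R := R)).X := inferInstanceAs (Unique PUnit)

instance (G H : Dialectica.{w} R) [Unique G.X] [Unique H.X] : Unique (tensor G H).X :=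
  Unique.mk' (G.X × H.X)

instance (G H : Dialectica.{w} R) [Nonempty G.X] [IsEmpty H.Y] : IsEmpty (tensor G H).Y :=
  inferInstanceAs (IsEmpty ((H.X → G.Y) × (G.X → H.Y)))

end Dialectica

theorem IndexedCategory.IsExtensive.nonempty_unique_hom {C : Type u} [Category.{v} C]
    [HasFiniteCoproducts C] (E : IndexedCategory.{v, u, v', u'} C) [E.IsExtensive] {A : C}
    (hA : IsInitial A) (G H : E.Fib A) : Nonempty (Unique (G ⟶ H)) :=
  ((equiv_punit_iff_unique _).1 (initial A hA)).2 G H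

namespace IndexedDialectica

variable {C : Type u} [Category.{v} C] [CartesianMonoidalCategory C] [MonoidalClosed C]
  {E : IndexedCategory.{v, u, v', u'} C}

/-- The functor `A ⊗ -` is a left adjoint, so every family indexed by `A ⊗ G.Y` lies over an initial
object and the fibre components of morphisms into `G` exist and are unique. -/
noncomputable def isTerminalOfIsTerminalXOfIsInitialY [HasFiniteCoproducts C] [E.IsExtensive]
    {G : IndexedDialectica E} (hX : IsTerminal G.X) (hY : IsInitial G.Y) : IsTerminal G :=
  have hom_unique (A : C) (K L : E.Fib (A ⊗ G.Y)) : Nonempty (Unique (K ⟶ L)) :=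
    IndexedCategory.IsExtensive.nonempty_unique_hom E (hY.isInitialObj (tensorLeft A)) K L
  .ofUniqueHom
    (fun _ => ⟨hX.from _, hY.to _, (hom_unique _ _ _).some.default⟩)
    fun _ _ => Hom.ext' (hX.hom_ext _ _) (hY.hom_ext _ _)
      ((hom_unique _ _ _).some.instSubsingleton.elim _ _)

variable [IndexedStarAutonomous E]

/-- A counter-witness of `G ⊗ H` contains a map `G.X ⟶ H.Y`; its value at `x` lies in an initial
object, and initial objects of a cartesian closed category are strict. -/
noncomputable def isInitialTensorY (G H : IndexedDialectica E) (x : 𝟙_ C ⟶ G.X)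
    (hH : IsInitial H.Y) : IsInitial (tensor G H).Y :=
  let eval_at_x : (tensor G H).Y ⟶ H.Y :=
    snd _ _ ≫ lift (toUnit _ ≫ x) (𝟙 _) ≫ (ihom.ev G.X).app H.Y
  have := strict_initial hH eval_at_x
  hH.ofIso (asIso eval_at_x).symm

def isTerminalTensorX {G H : IndexedDialectica E} (hG : IsTerminal G.X) (hH : IsTerminal H.X) :
    IsTerminal (tensor G H).X :=
  .ofUniqueHom (fun _ => lift (hG.from _) (hH.from _)) fun _ _ =>
    hom_ext _ _ (hG.hom_ext _ _) (hH.hom_ext _ _)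

variable [HasFiniteCoproducts C]

noncomputable def isTerminalTop [E.IsExtensive] : IsTerminal (top (E := E)) :=
  isTerminalOfIsTerminalXOfIsInitialY isTerminalTensorUnit initialIsInitial

noncomputable def isTerminalTensorBotTop [E.IsExtensive] :
    IsTerminal (tensor (E := E) bot top) :=
  isTerminalOfIsTerminalXOfIsInitialY
    (isTerminalTensorX isTerminalTensorUnit isTerminalTensorUnit)
    (isInitialTensorY bot top (𝟙 _) initialIsInitial)

end IndexedDialectica

theorem mainTheorem9 (Atom : Type a) :
    -- `⊥ ⊗ ⊤` is not provable in classical linear logic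
    ¬ (LLFormula.tensor .bot .top : LLFormula Atom).Provable ∧
    -- dialectica transformations, over sets, of models of multiplicative exponential linear logic
    (∀ (R : Type u) [Category.{v} R] [MonoidalCategory R] [SymmetricCategory R]
        [StarAutonomous R] (S : Type u') [Category.{v'} S] [CartesianMonoidalCategory S]
        [SymmetricCategory S] (ℛ : LinearNonlinearAdjunction R S),
      Nonempty (Dialectica.tensor.{w} (R := R) Dialectica.bot Dialectica.top ≅ Dialectica.top) ∧
      (Dialectica.interpretation.{w} ℛ).Validates
        (LLFormula.tensor .bot .top : LLFormula Atom) ∧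
      ¬ (Dialectica.interpretation.{w} ℛ).IsComplete Atom ∧
      ¬ ((Dialectica.interpretation.{w} ℛ).IsSound Atom ∧
        (Dialectica.interpretation.{w} ℛ).IsComplete Atom)) ∧
    -- dialectica categories over an arbitrary cartesian closed base, with any interpretation of `!`
    (∀ (C : Type u) [Category.{v} C] [CartesianMonoidalCategory C] [MonoidalClosed C]
        [HasFiniteCoproducts C] (E : IndexedCategory.{v, u, v', u'} C) [IndexedStarAutonomous E]
        [E.IsExtensive] (bang : IndexedDialectica E → IndexedDialectica E),
      Nonempty (IndexedDialectica.tensor (E := E) IndexedDialectica.bot IndexedDialectica.top ≅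
        IndexedDialectica.top) ∧
      (IndexedDialectica.interpretation bang).Validates
        (LLFormula.tensor .bot .top : LLFormula Atom) ∧
      ¬ (IndexedDialectica.interpretation bang).IsComplete Atom ∧
      ¬ ((IndexedDialectica.interpretation bang).IsSound Atom ∧
        (IndexedDialectica.interpretation bang).IsComplete Atom)) := by
  have h_unprovable := LLFormula.not_provable_tensor_bot (.top : LLFormula Atom)
  refine ⟨h_unprovable, ?_, ?_⟩
  · intro R _ _ _ _ S _ _ _ ℛ
    have h_terminal :=
      Dialectica.isTerminalOfUniqueXOfIsEmptyY (Dialectica.tensor.{w} (R := R) .bot .top)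
    have h_valid : (Dialectica.interpretation.{w} ℛ).Validates
        (LLFormula.tensor .bot .top : LLFormula Atom) := fun _ => ⟨h_terminal.from _⟩
    have h_incomplete : ¬ (Dialectica.interpretation.{w} ℛ).IsComplete Atom :=
      fun h_complete => h_unprovable (h_complete.provable_of_validates h_valid)
    exact ⟨⟨h_terminal.uniqueUpToIso (Dialectica.isTerminalOfUniqueXOfIsEmptyY .top)⟩,
      h_valid, h_incomplete, fun h => h_incomplete h.2⟩
  · intro C _ _ _ _ E _ _ bang
    have h_terminal := IndexedDialectica.isTerminalTensorBotTop (E := E)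
    have h_valid : (IndexedDialectica.interpretation bang).Validates
        (LLFormula.tensor .bot .top : LLFormula Atom) := fun _ => ⟨h_terminal.from _⟩
    have h_incomplete : ¬ (IndexedDialectica.interpretation bang).IsComplete Atom :=
      fun h_complete => h_unprovable (h_complete.provable_of_validates h_valid)
    exact ⟨⟨h_terminal.uniqueUpToIso IndexedDialectica.isTerminalTop⟩,
      h_valid, h_incomplete, fun h => h_incomplete h.2⟩
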